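/- **Theorem.** Fix $0<p<1$ and consider the locally random Fibonacci substitution $\zeta$ on the alphabet $\mathcal A=\{a,b\}$, given by $a\mapsto ba$ with probability $p$, $a\mapsto ab$ with probability $1-p$, and $b\mapsto a$, where the choice is made independently for each occurrence of the letter $a$ in a word. Let $\Sigma\subseteq\mathcal A^{\mathbb Z}$ be the set of all bi-infinite words each of whose finite subwords is a subword of some realisation (a value attained with positive probability) of $\zeta^k(b)$ for some $k\in\mathbb N$, with the topology induced by the product topology of $\mathcal A^{\mathbb Z}$ ($\mathcal A$ discrete), and let $S:\Sigma\to\Sigma$, $(Sw)_i=w_{i+1}$, be the shift. Let $$\Omega=(\Sigma\times\mathbb R)/\!\sim$$ be the tiling space of $\zeta$, realised as the suspension of $(\Sigma,S)$, i.e. the quotient space by the equivalence relation generated by $(w,t)\sim(Sw,t-1)$. Then the first Čech cohomology group $\check H^1(\Omega)=\check H^1(\Omega;\mathbb Z)$, i.e. the direct limit over the open covers of $\Omega$, ordered by refinement, of the first integral cohomology groups of their nerves, is not finitely generated as an abelian group. -/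

import Mathlib

/-! ### Čech cohomology of a topological space with integer coefficients -/

namespace Cech

/-- An open cover of `X`, given as a set of open sets. -/
structure OpenCover (X : Type*) [TopologicalSpace X] where
  /-- The members of the cover. -/
  sets : Set (Set X)
  isOpen_of_mem : ∀ u ∈ sets, IsOpen u
  sUnion_eq_univ : ⋃₀ sets = Set.univ

variable {X : Type*} [TopologicalSpace X]

/-- `U ≤ V` means that `V` is a refinement of `U`:
every member of `V` is contained in some member of `U`. -/
instance : Preorder (OpenCover X) where
  le U V := ∀ v ∈ V.sets, ∃ u ∈ U.sets, v ⊆ u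
  le_refl U := fun u hu => ⟨u, hu, subset_rfl⟩
  le_trans U V W hUV hVW := fun w hw => by
    obtain ⟨v, hv, hwv⟩ := hVW w hw
    obtain ⟨u, hu, hvu⟩ := hUV v hv
    exact ⟨u, hu, hwv.trans hvu⟩

/-- The (ordered) `n`-simplices of the nerve of `U`: the `(n+1)`-tuples of members of `U`
with nonempty intersection. -/
@[ext]
structure Simplex (U : OpenCover X) (n : ℕ) where
  /-- The vertices of the simplex. -/
  vertex : Fin (n + 1) → U.sets
  nonempty : (⋂ i, (vertex i : Set X)).Nonempty

/-- The `i`-th face of a simplex, obtained by omitting the `i`-th vertex. -/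
def Simplex.face {U : OpenCover X} {n : ℕ} (σ : Simplex U (n + 1)) (i : Fin (n + 2)) :
    Simplex U n :=
  ⟨fun j => σ.vertex (i.succAbove j), by
    obtain ⟨x, hx⟩ := σ.nonempty
    exact ⟨x, Set.mem_iInter.2 fun j => Set.mem_iInter.1 hx (i.succAbove j)⟩⟩

/-- The Čech `n`-cochains of the cover `U` with coefficients in `ℤ`. -/
abbrev Cochain (U : OpenCover X) (n : ℕ) : Type _ := Simplex U n → ℤ

/-- The coboundary `(d c)(σ) = ∑ i, (-1) ^ i * c (face i of σ)`. -/
def d (U : OpenCover X) (n : ℕ) : Cochain U n →ₗ[ℤ] Cochain U (n + 1) where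
  toFun c := fun σ => ∑ i : Fin (n + 2), (-1) ^ (i : ℕ) * c (σ.face i)
  map_add' c c' := by
    funext σ
    simp [mul_add, Finset.sum_add_distrib]
  map_smul' m c := by
    funext σ
    simp [Finset.mul_sum, mul_left_comm]

theorem d_apply (U : OpenCover X) (n : ℕ) (c : Cochain U n) (σ : Simplex U (n + 1)) :
    d U n c σ = ∑ i : Fin (n + 2), (-1) ^ (i : ℕ) * c (σ.face i) := rfl

/-- The Čech `n`-cocycles of the cover `U`. -/
abbrev cocycles (U : OpenCover X) (n : ℕ) : Submodule ℤ (Cochain U n) := LinearMap.ker (d U n)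

/-- The Čech `n`-coboundaries of the cover `U`; there are none but `0` in degree `0`. -/
def coboundaries (U : OpenCover X) : (n : ℕ) → Submodule ℤ (Cochain U n)
  | 0 => ⊥
  | n + 1 => LinearMap.range (d U n)

/-- The `n`-th Čech cohomology group of the cover `U`: cocycles modulo coboundaries. -/
abbrev CoverCohomology (U : OpenCover X) (n : ℕ) : Type _ :=
  cocycles U n ⧸ (coboundaries U n).submoduleOf (cocycles U n)

/-- A refinement projection: it sends each member of the finer cover `V`
to a member of the coarser cover `U` that contains it. -/
structure RefinementMap (U V : OpenCover X) where
  /-- The underlying map of members. -/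
  toFun : V.sets → U.sets
  subset : ∀ v : V.sets, (v : Set X) ⊆ (toFun v : Set X)

namespace RefinementMap

variable {U V : OpenCover X} (τ : RefinementMap U V)

/-- The simplicial map of nerves that a refinement projection induces. -/
def onSimplex {n : ℕ} (σ : Simplex V n) : Simplex U n :=
  ⟨fun i => τ.toFun (σ.vertex i), by
    obtain ⟨x, hx⟩ := σ.nonempty
    exact ⟨x, Set.mem_iInter.2 fun i => τ.subset _ (Set.mem_iInter.1 hx i)⟩⟩

/-- Pullback of cochains along a refinement projection. -/
def pullback (n : ℕ) : Cochain U n →ₗ[ℤ] Cochain V n := LinearMap.funLeft ℤ ℤ τ.onSimplex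

theorem d_pullback (n : ℕ) (c : Cochain U n) :
    d V n (τ.pullback n c) = τ.pullback (n + 1) (d U n c) := rfl

theorem pullback_mem_cocycles (n : ℕ) (c : Cochain U n) (hc : c ∈ cocycles U n) :
    τ.pullback n c ∈ cocycles V n := by
  rw [LinearMap.mem_ker] at hc ⊢
  rw [d_pullback, hc, map_zero]

theorem pullback_mem_coboundaries (n : ℕ) (c : Cochain U n) (hc : c ∈ coboundaries U n) :
    τ.pullback n c ∈ coboundaries V n := by
  cases n with
  | zero =>
    have h0 : c = 0 := by simpa [coboundaries] using hc
    rw [h0, map_zero]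
    exact Submodule.zero_mem _
  | succ n =>
    obtain ⟨b, rfl⟩ := hc
    exact ⟨τ.pullback n b, τ.d_pullback n b⟩

/-- Pullback of cocycles along a refinement projection. -/
def onCocycles (n : ℕ) : cocycles U n →ₗ[ℤ] cocycles V n :=
  (τ.pullback n).restrict (τ.pullback_mem_cocycles n)

theorem submoduleOf_le_comap (n : ℕ) : (coboundaries U n).submoduleOf (cocycles U n) ≤
    ((coboundaries V n).submoduleOf (cocycles V n)).comap (τ.onCocycles n) :=
  fun c hc => τ.pullback_mem_coboundaries n c.1 hc

/-- The map on cohomology that a refinement projection induces. -/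
def onCohomology (n : ℕ) : CoverCohomology U n →ₗ[ℤ] CoverCohomology V n :=
  Submodule.mapQ _ _ (τ.onCocycles n) (τ.submoduleOf_le_comap n)

/-- A refinement projection for a pair of covers one of which refines the other. -/
noncomputable def ofLE (h : U ≤ V) : RefinementMap U V where
  toFun v := ⟨(h v.1 v.2).choose, (h v.1 v.2).choose_spec.1⟩
  subset v := (h v.1 v.2).choose_spec.2

end RefinementMap

open Classical in
/-- The `n`-th Čech cohomology group of `X` with coefficients in `ℤ`: the direct limit of the
cohomology groups of the nerves of the open covers of `X`, ordered by refinement.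
(As is well known, different refinement projections between the same two covers induce the
same map on cohomology, so that the choice made in `RefinementMap.ofLE` is immaterial.) -/
abbrev Cohomology (n : ℕ) (X : Type*) [TopologicalSpace X] : Type _ :=
  Module.DirectLimit (R := ℤ) (fun U : OpenCover X => CoverCohomology U n)
    (fun _ _ h => (RefinementMap.ofLE h).onCohomology n)

end Cech

/-! ### The locally random Fibonacci substitution and its tiling space -/

namespace RandomFibonacci

/-- The alphabet `{a, b}`. -/
inductive Letter where
  | a
  | b

/-- The alphabet carries the discrete topology. -/
instance : TopologicalSpace Letter := ⊥

instance : DiscreteTopology Letter := ⟨rfl⟩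

/-- A biased coin: `true` with probability `p` and `false` with probability `1 - p`. -/
noncomputable def coin (p : Set.Ioo (0 : ℝ) 1) : PMF Bool :=
  PMF.ofFintype (fun c => if c then ENNReal.ofReal p else ENNReal.ofReal (1 - p)) (by
    have h0 : (0 : ℝ) ≤ p := p.2.1.le
    have h1 : (0 : ℝ) ≤ 1 - p := sub_nonneg.2 p.2.2.le
    simp [← ENNReal.ofReal_add h0 h1])

/-- The random image of a letter: `a ↦ ba` with probability `p`, `a ↦ ab` with probability
`1 - p`, and `b ↦ a`. -/
noncomputable def substLetter (p : Set.Ioo (0 : ℝ) 1) : Letter → PMF (List Letter)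
  | .a => (coin p).map fun c => if c then [.b, .a] else [.a, .b]
  | .b => PMF.pure [.a]

/-- The random image of a word: the substitution is applied to each letter independently and
the results are concatenated. -/
noncomputable def substWord (p : Set.Ioo (0 : ℝ) 1) : List Letter → PMF (List Letter)
  | [] => PMF.pure []
  | x :: w => (substLetter p x).bind fun u => (substWord p w).bind fun v => PMF.pure (u ++ v)

/-- The law of the random word obtained from the letter `b` by `k` applications of the
random substitution. -/
noncomputable def iterate (p : Set.Ioo (0 : ℝ) 1) : ℕ → PMF (List Letter)
  | 0 => PMF.pure [.b]
  | k + 1 => (iterate p k).bind (substWord p)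

/-- A finite word is legal if it is a subword (that is, a contiguous block) of some realisation
of the `k`-fold random image of `b`, for some `k`. A realisation is a value that is attained
with positive probability. -/
def IsLegal (p : Set.Ioo (0 : ℝ) 1) (u : List Letter) : Prop :=
  ∃ k : ℕ, ∃ v ∈ (iterate p k).support, u <:+: v

/-- The symbolic tiling space: the bi-infinite words all of whose finite subwords are legal,
as a subspace of the product space of bi-infinite words. -/
def symbolicSpace (p : Set.Ioo (0 : ℝ) 1) : Set (ℤ → Letter) :=
  {w | ∀ (i : ℤ) (n : ℕ), IsLegal p (List.ofFn fun j : Fin n => w (i + (j : ℕ)))}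

/-- The shift `(S w) i = w (i + 1)` of the symbolic tiling space. -/
def shift {p : Set.Ioo (0 : ℝ) 1} (w : symbolicSpace p) : symbolicSpace p :=
  ⟨fun i => w.1 (i + 1), fun i n => by
    have h := w.2 (i + 1) n
    have e : (fun j : Fin n => w.1 (i + 1 + (j : ℕ))) =
        fun j : Fin n => w.1 (i + (j : ℕ) + 1) := by
      funext j
      exact congrArg w.1 (by ring)
    rwa [e] at h⟩

/-- The tiling space `Ω`: the suspension of the shift on the symbolic tiling space, that is, the
quotient of `symbolicSpace p × ℝ`, with the quotient topology, by the equivalence relation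
generated by `(w, t) ∼ (S w, t - 1)`. -/
abbrev TilingSpace (p : Set.Ioo (0 : ℝ) 1) : Type :=
  Quot fun x y : symbolicSpace p × ℝ => y = (shift x.1, x.2 - 1)

end RandomFibonacci

/-! ### First Čech cohomology and circle-valued maps -/

/-! A locally constant `g : Σ → ℤ` gives a circle-valued map on the tiling space that winds `g w`
times along the tile at the origin of `w`. Local real lifts of a circle-valued map differ by
integers on overlaps, which defines a homomorphism `Cech.circleClass` into Ȟ¹, and a map of class
zero has a global continuous real lift (`Cech.exists_lift_of_circleClass_eq_zero`). For the winding
map of `g`, such a lift exhibits `g` as `h ∘ S - h` with `h` bounded, so the Birkhoff sums of `g`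
are bounded.

For cylinder functions these sums count occurrences of words, up to a bounded error. Let `φ = fibA`
be the Fibonacci image followed by `a`. It preserves legality, and `φ v` occurs in `φ x` exactly as
often as `v` occurs in `x` (`occ_fibA`). Hence in `φ^j z` the word `φ^j(bb)` occurs as often as `bb`
does in `z`, whereas `φ^i(bb)` with `i < j` does not occur, because `bb` never occurs in an image of
`φ`. Mixing the two images of `a` produces legal `z` with arbitrarily many `bb`
(`exists_isLegal_le_occ_bb`). In a relation among the classes of the `φ^i(bb)`, testing on `φ^j z`,
with `j` the largest index present, makes the counts unbounded. The classes are therefore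
independent over ℤ and Ȟ¹ has infinite rank. -/

namespace Cech

variable {X : Type*} [TopologicalSpace X]

/-- The member of `U` that is the `i`-th vertex of a simplex, as a subset of `X`. -/
abbrev Simplex.member {U : OpenCover X} {n : ℕ} (σ : Simplex U n) (i : Fin (n + 1)) : Set X :=
  (σ.vertex i : Set X)

/-- The `0`-simplex given by a nonempty member of a cover. -/
def Simplex.point {U : OpenCover X} (u : U.sets) (hu : (u : Set X).Nonempty) : Simplex U 0 :=
  ⟨fun _ => u, by obtain ⟨x, hx⟩ := hu; exact ⟨x, Set.mem_iInter.2 fun _ => hx⟩⟩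

/-- The `1`-simplex given by two members of a cover with a common point. -/
def Simplex.edge {U : OpenCover X} (u v : U.sets) (x : X) (hu : x ∈ (u : Set X))
    (hv : x ∈ (v : Set X)) : Simplex U 1 :=
  ⟨![u, v], x, Set.mem_iInter.2 fun i => by fin_cases i <;> simpa⟩

/-- The `2`-simplex given by three members of a cover with a common point. -/
def Simplex.triangle {U : OpenCover X} (u v w : U.sets) (x : X) (hu : x ∈ (u : Set X))
    (hv : x ∈ (v : Set X)) (hw : x ∈ (w : Set X)) : Simplex U 2 :=
  ⟨![u, v, w], x, Set.mem_iInter.2 fun i => by fin_cases i <;> simpa⟩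

theorem Simplex.exists_mem {U : OpenCover X} {n : ℕ} (σ : Simplex U n) :
    ∃ x, ∀ i, x ∈ σ.member i := by
  obtain ⟨x, hx⟩ := σ.nonempty
  exact ⟨x, Set.mem_iInter.1 hx⟩

theorem Simplex.exists_eq_edge {U : OpenCover X} (σ : Simplex U 1) :
    ∃ (u v : U.sets) (x : X) (hu : x ∈ (u : Set X)) (hv : x ∈ (v : Set X)),
      σ = Simplex.edge u v x hu hv := by
  obtain ⟨x, hx⟩ := σ.exists_mem
  refine ⟨σ.vertex 0, σ.vertex 1, x, hx 0, hx 1, ?_⟩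
  ext i
  fin_cases i <;> rfl

theorem d_zero_apply {U : OpenCover X} (b : Cochain U 0) (u v : U.sets) (x : X)
    (hu : x ∈ (u : Set X)) (hv : x ∈ (v : Set X)) :
    d U 0 b (Simplex.edge u v x hu hv) =
      b (Simplex.point v ⟨x, hv⟩) - b (Simplex.point u ⟨x, hu⟩) := by
  have h0 : (Simplex.edge u v x hu hv).face 0 = Simplex.point v ⟨x, hv⟩ := by
    ext i; fin_cases i; rfl
  have h1 : (Simplex.edge u v x hu hv).face 1 = Simplex.point u ⟨x, hu⟩ := by
    ext i; fin_cases i; rfl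
  rw [d_apply, Fin.sum_univ_two, h0, h1]
  simp [sub_eq_add_neg]

theorem d_one_apply {U : OpenCover X} (c : Cochain U 1) (u v w : U.sets) (x : X)
    (hu : x ∈ (u : Set X)) (hv : x ∈ (v : Set X)) (hw : x ∈ (w : Set X)) :
    d U 1 c (Simplex.triangle u v w x hu hv hw) =
      c (Simplex.edge v w x hv hw) - c (Simplex.edge u w x hu hw) +
        c (Simplex.edge u v x hu hv) := by
  have h0 : (Simplex.triangle u v w x hu hv hw).face 0 = Simplex.edge v w x hv hw := by
    ext i; fin_cases i <;> rfl
  have h1 : (Simplex.triangle u v w x hu hv hw).face 1 = Simplex.edge u w x hu hw := by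
    ext i; fin_cases i <;> rfl
  have h2 : (Simplex.triangle u v w x hu hv hw).face 2 = Simplex.edge u v x hu hv := by
    ext i; fin_cases i <;> rfl
  rw [d_apply, Fin.sum_univ_three, h0, h1, h2]
  simp [sub_eq_add_neg]

theorem Simplex.exists_eq_triangle {U : OpenCover X} (σ : Simplex U 2) :
    ∃ (u v w : U.sets) (x : X) (hu : x ∈ (u : Set X)) (hv : x ∈ (v : Set X))
      (hw : x ∈ (w : Set X)), σ = Simplex.triangle u v w x hu hv hw := by
  obtain ⟨x, hx⟩ := σ.exists_mem
  refine ⟨σ.vertex 0, σ.vertex 1, σ.vertex 2, x, hx 0, hx 1, hx 2, ?_⟩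
  ext i
  fin_cases i <;> rfl

theorem cocycle_edge_add {U : OpenCover X} {c : Cochain U 1} (hc : c ∈ cocycles U 1)
    (u v w : U.sets) (x : X)
    (hu : x ∈ (u : Set X)) (hv : x ∈ (v : Set X)) (hw : x ∈ (w : Set X)) :
    c (Simplex.edge u v x hu hv) + c (Simplex.edge v w x hv hw) = c (Simplex.edge u w x hu hw) := by
  have h := congrFun (LinearMap.mem_ker.1 hc) (Simplex.triangle u v w x hu hv hw)
  rw [d_one_apply] at h
  simp only [Pi.zero_apply] at h
  linarith

/-- The class of a cocycle in the cohomology of a cover. -/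
def coverClass (U : OpenCover X) (n : ℕ) : cocycles U n →ₗ[ℤ] CoverCohomology U n :=
  Submodule.mkQ _

theorem coverClass_eq_zero {U : OpenCover X} {n : ℕ} (c : cocycles U n) :
    coverClass U n c = 0 ↔ c.1 ∈ coboundaries U n := by
  unfold coverClass
  rw [Submodule.mkQ_apply, Submodule.Quotient.mk_eq_zero]
  rfl

theorem coverClass_surjective (U : OpenCover X) (n : ℕ) :
    Function.Surjective (coverClass U n) := Submodule.mkQ_surjective _

theorem RefinementMap.onCohomology_coverClass {U V : OpenCover X} (τ : RefinementMap U V) (n : ℕ)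
    (c : cocycles U n) :
    τ.onCohomology n (coverClass U n c) = coverClass V n (τ.onCocycles n c) := rfl

/-- Any two refinement projections induce the same map on first cohomology. -/
theorem RefinementMap.onCohomology_one_eq {U V : OpenCover X} (τ τ' : RefinementMap U V) :
    τ.onCohomology 1 = τ'.onCohomology 1 := by
  refine LinearMap.ext fun y => ?_
  obtain ⟨c, rfl⟩ := coverClass_surjective U 1 y
  rw [onCohomology_coverClass, onCohomology_coverClass, ← sub_eq_zero, ← map_sub,
    coverClass_eq_zero]
  -- The usual chain homotopy: the value at `u` is that of `c` on the edge from `τ' u` to `τ u`. The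
  -- two triangles of the prism over an edge `uv` give the identity.
  refine ⟨fun σ => c.1 (Simplex.edge (τ'.toFun (σ.vertex 0)) (τ.toFun (σ.vertex 0))
    σ.exists_mem.choose (τ'.subset _ (σ.exists_mem.choose_spec 0))
    (τ.subset _ (σ.exists_mem.choose_spec 0))), ?_⟩
  funext σ
  obtain ⟨u, v, x, hu, hv, rfl⟩ := σ.exists_eq_edge
  rw [d_zero_apply]
  have h1 := cocycle_edge_add c.2 (τ'.toFun u) (τ'.toFun v) (τ.toFun v) x (τ'.subset _ hu)
    (τ'.subset _ hv) (τ.subset _ hv)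
  have h2 := cocycle_edge_add c.2 (τ'.toFun u) (τ.toFun u) (τ.toFun v) x (τ'.subset _ hu)
    (τ.subset _ hu) (τ.subset _ hv)
  have e (ρ : RefinementMap U V) : ((ρ.onCocycles 1 c).1 (Simplex.edge u v x hu hv)) =
      c.1 (Simplex.edge (ρ.toFun u) (ρ.toFun v) x (ρ.subset _ hu) (ρ.subset _ hv)) := by
    refine congrArg c.1 ?_
    ext i
    fin_cases i <;> rfl
  change _ = (τ.onCocycles 1 c).1 _ - (τ'.onCocycles 1 c).1 _
  rw [e, e]
  change c.1 (Simplex.edge (τ'.toFun v) (τ.toFun v) x (τ'.subset _ hv) (τ.subset _ hv)) -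
    c.1 (Simplex.edge (τ'.toFun u) (τ.toFun u) x (τ'.subset _ hu) (τ.subset _ hu)) = _
  linarith

instance : IsDirectedOrder (OpenCover X) where
  directed U V := by
    refine ⟨⟨{w | ∃ u ∈ U.sets, ∃ v ∈ V.sets, w = u ∩ v}, ?_, ?_⟩, ?_, ?_⟩
    · rintro _ ⟨u, hu, v, hv, rfl⟩
      exact (U.isOpen_of_mem u hu).inter (V.isOpen_of_mem v hv)
    · refine Set.eq_univ_of_forall fun x => ?_
      obtain ⟨u, hu, hxu⟩ := Set.mem_sUnion.1 (U.sUnion_eq_univ ▸ Set.mem_univ x)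
      obtain ⟨v, hv, hxv⟩ := Set.mem_sUnion.1 (V.sUnion_eq_univ ▸ Set.mem_univ x)
      exact ⟨u ∩ v, ⟨u, hu, v, hv, rfl⟩, hxu, hxv⟩
    · rintro _ ⟨u, hu, v, hv, rfl⟩
      exact ⟨u, hu, Set.inter_subset_left⟩
    · rintro _ ⟨u, hu, v, hv, rfl⟩
      exact ⟨v, hv, Set.inter_subset_right⟩

theorem OpenCover.exists_mem (U : OpenCover X) (x : X) : ∃ u : U.sets, x ∈ (u : Set X) := by
  obtain ⟨u, hu, hxu⟩ := Set.mem_sUnion.1 (U.sUnion_eq_univ ▸ Set.mem_univ x)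
  exact ⟨⟨u, hu⟩, hxu⟩

/-- The chosen projections need not compose on cochains; functoriality holds on cohomology because
the induced map does not depend on the projection. -/
instance : DirectedSystem (fun U : OpenCover X => CoverCohomology U 1)
    (fun _ _ h => (RefinementMap.ofLE h).onCohomology 1) where
  map_self U y := by
    rw [RefinementMap.onCohomology_one_eq _ ⟨id, fun _ => subset_rfl⟩]
    obtain ⟨c, rfl⟩ := coverClass_surjective U 1 y
    rfl
  map_map W V U h h' y := by
    rw [RefinementMap.onCohomology_one_eq (RefinementMap.ofLE (h.trans h'))
      ⟨(RefinementMap.ofLE h).toFun ∘ (RefinementMap.ofLE h').toFun,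
        fun w => ((RefinementMap.ofLE h').subset w).trans ((RefinementMap.ofLE h).subset _)⟩]
    obtain ⟨c, rfl⟩ := coverClass_surjective U 1 y
    rfl

open Classical in
/-- The class in `Ȟ¹(X)` of a cocycle of a cover. -/
noncomputable def cechClass (U : OpenCover X) : cocycles U 1 →+ Cohomology 1 X :=
  (Module.DirectLimit.of ℤ (OpenCover X) (fun U : OpenCover X => CoverCohomology U 1)
    (fun _ _ h => (RefinementMap.ofLE h).onCohomology 1) U).toAddMonoidHom.comp
      (coverClass U 1).toAddMonoidHom

theorem cechClass_onCocycles {U V : OpenCover X} (h : U ≤ V) (c : cocycles U 1) :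
    cechClass V ((RefinementMap.ofLE h).onCocycles 1 c) = cechClass U c := by
  classical
  exact Module.DirectLimit.of_f (R := ℤ) (G := fun U : OpenCover X => CoverCohomology U 1)
    (f := fun _ _ h => (RefinementMap.ofLE h).onCohomology 1) (hij := h) (x := coverClass U 1 c)

theorem cechClass_eq_zero_of_mem {U : OpenCover X} {c : cocycles U 1}
    (hc : c.1 ∈ coboundaries U 1) : cechClass U c = 0 := by
  classical
  refine (congrArg (Module.DirectLimit.of ℤ (OpenCover X)
    (fun U : OpenCover X => CoverCohomology U 1)
    (fun _ _ h => (RefinementMap.ofLE h).onCohomology 1) U) ((coverClass_eq_zero c).2 hc)).trans ?_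
  exact map_zero _

theorem exists_coboundary_of_cechClass_eq_zero {U : OpenCover X} {c : cocycles U 1}
    (hc : cechClass U c = 0) :
    ∃ (V : OpenCover X) (τ : RefinementMap U V), τ.pullback 1 c.1 ∈ coboundaries V 1 := by
  classical
  obtain ⟨V, hV, h⟩ := Module.DirectLimit.of.zero_exact (R := ℤ)
    (G := fun U : OpenCover X => CoverCohomology U 1)
    (f := fun _ _ h => (RefinementMap.ofLE h).onCohomology 1) hc
  exact ⟨V, RefinementMap.ofLE hV, (coverClass_eq_zero _).1 h⟩

/-! ### Cocycles from local real lifts -/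

/-- A family of real functions on the members of a cover represents a `1`-cochain
if the cochain is given by the differences of the functions on the overlaps. -/
def Represents (U : OpenCover X) (θ : U.sets → X → ℝ) (c : Cochain U 1) : Prop :=
  ∀ (u v : U.sets) (x : X) (hu : x ∈ (u : Set X)) (hv : x ∈ (v : Set X)),
    (c (Simplex.edge u v x hu hv) : ℝ) = θ v x - θ u x

theorem Represents.mem_cocycles {U : OpenCover X} {θ : U.sets → X → ℝ} {c : Cochain U 1}
    (h : Represents U θ c) : c ∈ cocycles U 1 := by
  rw [LinearMap.mem_ker]
  funext σ
  obtain ⟨u, v, w, x, hu, hv, hw, rfl⟩ := σ.exists_eq_triangle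
  rw [d_one_apply]
  rify
  rw [h, h, h]
  simp

theorem Represents.pullback {U V : OpenCover X} {θ : U.sets → X → ℝ} {c : Cochain U 1}
    (h : Represents U θ c) (τ : RefinementMap U V) :
    Represents V (fun v => θ (τ.toFun v)) (τ.pullback 1 c) := by
  intro u v x hu hv
  rw [← h (τ.toFun u) (τ.toFun v) x (τ.subset _ hu) (τ.subset _ hv)]
  refine congrArg (fun s => (c s : ℝ)) ?_
  ext i
  fin_cases i <;> rfl

theorem Represents.sub {U : OpenCover X} {θ θ' : U.sets → X → ℝ} {c c' : Cochain U 1}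
    (h : Represents U θ c) (h' : Represents U θ' c') :
    Represents U (fun u x => θ u x - θ' u x) (c - c') := by
  intro u v x hu hv
  rw [Pi.sub_apply, Int.cast_sub, h, h']
  ring

theorem Represents.mem_coboundaries {U : OpenCover X} {θ : U.sets → X → ℝ} {c : Cochain U 1}
    (h : Represents U θ c) (n : U.sets → ℤ)
    (hn : ∀ u : U.sets, ∀ x ∈ (u : Set X), θ u x = n u) : c ∈ coboundaries U 1 := by
  refine ⟨fun σ => n (σ.vertex 0), ?_⟩
  funext σ
  obtain ⟨u, v, x, hu, hv, rfl⟩ := σ.exists_eq_edge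
  rw [d_zero_apply]
  rify
  rw [h, hn _ x hu, hn _ x hv]
  rfl

theorem exists_int_of_coe_eq {s t : ℝ} (h : (s : AddCircle (1 : ℝ)) = t) : ∃ k : ℤ, s - t = k := by
  obtain ⟨k, hk⟩ := (AddCircle.coe_eq_zero_iff (1 : ℝ)).1
    (show ((s - t : ℝ) : AddCircle (1 : ℝ)) = 0 by rw [AddCircle.coe_sub, h, sub_self])
  exact ⟨k, by simpa using hk.symm⟩

/-- `θ` is a continuous real lift of `f` on `u` that varies by less than `1 / 8`. -/
structure IsLiftOn (f : X → AddCircle (1 : ℝ)) (u : Set X) (θ : X → ℝ) : Prop where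
  coe_eq : ∀ x ∈ u, (θ x : AddCircle (1 : ℝ)) = f x
  abs_sub_lt : ∀ x ∈ u, ∀ y ∈ u, |θ x - θ y| < 1 / 8
  continuousOn : ContinuousOn θ u

theorem IsLiftOn.mono {f : X → AddCircle (1 : ℝ)} {u v : Set X} {θ : X → ℝ}
    (h : IsLiftOn f u θ) (hv : v ⊆ u) : IsLiftOn f v θ :=
  ⟨fun x hx => h.coe_eq x (hv hx), fun x hx y hy => h.abs_sub_lt x (hv hx) y (hv hy),
    h.continuousOn.mono hv⟩

theorem exists_isLiftOn {f : X → AddCircle (1 : ℝ)} (hf : Continuous f) (x : X) :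
    ∃ u : Set X, IsOpen u ∧ x ∈ u ∧ ∃ θ, IsLiftOn f u θ := by
  obtain ⟨r, hr⟩ := QuotientAddGroup.mk_surjective (f x)
  have hr : (r : AddCircle (1 : ℝ)) = f x := hr
  set e := AddCircle.openPartialHomeomorphCoe (1 : ℝ) (r - 1 / 2) with he
  have hrs : r ∈ e.source := by
    change r ∈ Set.Ioo _ _
    constructor <;> linarith
  have her : e r = f x := hr
  have hx : f x ∈ e.target := her ▸ e.map_source hrs
  have hc : ContinuousOn (e.symm ∘ f) (f ⁻¹' e.target) :=
    e.continuousOn_symm.comp hf.continuousOn fun _ h => h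
  -- The lift is the local inverse of ℝ → ℝ/ℤ near `r`; confining it to a ball of radius 1/16 keeps
  -- its variation below 1/8.
  refine ⟨f ⁻¹' e.target ∩ (e.symm ∘ f) ⁻¹' Metric.ball r (1 / 16),
    hc.isOpen_inter_preimage (e.open_target.preimage hf) Metric.isOpen_ball, ⟨hx, ?_⟩,
    e.symm ∘ f, fun y hy => e.right_inv hy.1, fun y hy z hz => ?_,
    hc.mono Set.inter_subset_left⟩
  · have : e.symm (f x) = r := by rw [← her, e.left_inv hrs]
    simp [this]
  · have h1 := abs_lt.1 (Metric.mem_ball.1 hy.2)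
    have h2 := abs_lt.1 (Metric.mem_ball.1 hz.2)
    exact abs_lt.2 ⟨by linarith, by linarith⟩

/-- The cover of `X` by the open sets on which `f` has a real lift of small variation. -/
def liftCover (f : C(X, AddCircle (1 : ℝ))) : OpenCover X where
  sets := {u | IsOpen u ∧ ∃ θ, IsLiftOn f u θ}
  isOpen_of_mem _ h := h.1
  sUnion_eq_univ := Set.eq_univ_of_forall fun x => by
    obtain ⟨u, hu, hx, h⟩ := exists_isLiftOn f.continuous x
    exact ⟨u, ⟨hu, h⟩, hx⟩

/-- A choice of real lifts of `f` on the members of `liftCover f`. -/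
noncomputable def localLift (f : C(X, AddCircle (1 : ℝ))) (u : (liftCover f).sets) : X → ℝ :=
  u.2.2.choose

theorem isLiftOn_localLift (f : C(X, AddCircle (1 : ℝ))) (u : (liftCover f).sets) :
    IsLiftOn f u (localLift f u) := u.2.2.choose_spec

/-- The cochain of `liftCover f` of the differences of the local lifts of `f`. -/
noncomputable def liftCochain (f : C(X, AddCircle (1 : ℝ))) : Cochain (liftCover f) 1 := fun σ =>
  round (localLift f (σ.vertex 1) σ.exists_mem.choose -
    localLift f (σ.vertex 0) σ.exists_mem.choose)

/-- The difference of two lifts is an integer at every common point and varies by less than 1/8 +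
1/8 < 1, so it is constant on the overlap even if the overlap is disconnected. Hence the point
chosen in `liftCochain` is immaterial and `round` loses nothing. -/
theorem represents_liftCochain (f : C(X, AddCircle (1 : ℝ))) :
    Represents (liftCover f) (localLift f) (liftCochain f) := by
  intro u v x hu hv
  set σ := Simplex.edge u v x hu hv
  set y := σ.exists_mem.choose with hy
  have hyu : y ∈ (u : Set X) := σ.exists_mem.choose_spec 0
  have hyv : y ∈ (v : Set X) := σ.exists_mem.choose_spec 1
  have e : liftCochain f σ = round (localLift f v y - localLift f u y) := rfl
  have h1 := isLiftOn_localLift f u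
  have h2 := isLiftOn_localLift f v
  obtain ⟨k, hk⟩ := exists_int_of_coe_eq ((h2.coe_eq x hv).trans (h1.coe_eq x hu).symm)
  obtain ⟨l, hl⟩ := exists_int_of_coe_eq ((h2.coe_eq y hyv).trans (h1.coe_eq y hyu).symm)
  rw [e, hl, hk, round_intCast]
  have h3 := abs_lt.1 (h1.abs_sub_lt x hu y hyu)
  have h4 := abs_lt.1 (h2.abs_sub_lt x hv y hyv)
  have h5 : |(l : ℝ) - k| < 1 := abs_lt.2 ⟨by linarith, by linarith⟩
  have : |l - k| < 1 := by exact_mod_cast h5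
  rw [Int.abs_lt_one_iff, sub_eq_zero] at this
  rw [this]

/-- The class in `Ȟ¹(X)` of a circle-valued map, as a function. -/
noncomputable def circleClassFun (f : C(X, AddCircle (1 : ℝ))) : Cohomology 1 X :=
  cechClass (liftCover f) ⟨liftCochain f, (represents_liftCochain f).mem_cocycles⟩

/-- On a common refinement, the lift of `f + g` minus those of `f` and `g` is integer-valued with
variation below 3/8, hence constant on each member. These constants form a 0-cochain whose
coboundary is the difference of the cocycles. -/
theorem circleClassFun_add (f g : C(X, AddCircle (1 : ℝ))) :
    circleClassFun (f + g) = circleClassFun f + circleClassFun g := by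
  obtain ⟨V, hf, hg⟩ := exists_ge_ge (liftCover f) (liftCover g)
  obtain ⟨W, hV, hfg⟩ := exists_ge_ge V (liftCover (f + g))
  replace hf := hf.trans hV
  replace hg := hg.trans hV
  rw [circleClassFun, circleClassFun, circleClassFun, ← cechClass_onCocycles hf,
    ← cechClass_onCocycles hg, ← cechClass_onCocycles hfg, ← map_add, ← sub_eq_zero,
    ← map_sub, ← sub_sub]
  apply cechClass_eq_zero_of_mem
  have R := (((represents_liftCochain (f + g)).pullback (RefinementMap.ofLE hfg)).sub
    ((represents_liftCochain f).pullback (RefinementMap.ofLE hf))).sub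
    ((represents_liftCochain g).pullback (RefinementMap.ofLE hg))
  suffices h : ∀ w : W.sets, ∃ n : ℤ, ∀ x ∈ (w : Set X),
      localLift (f + g) ((RefinementMap.ofLE hfg).toFun w) x -
        localLift f ((RefinementMap.ofLE hf).toFun w) x -
        localLift g ((RefinementMap.ofLE hg).toFun w) x = n by
    choose n hn using h
    exact R.mem_coboundaries n hn
  intro w
  have Lf := (isLiftOn_localLift f _).mono ((RefinementMap.ofLE hf).subset w)
  have Lg := (isLiftOn_localLift g _).mono ((RefinementMap.ofLE hg).subset w)
  have Lfg := (isLiftOn_localLift (f + g) _).mono ((RefinementMap.ofLE hfg).subset w)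
  generalize localLift (f + g) _ = θ, localLift g _ = β, localLift f _ = α at *
  have key : ∀ x ∈ (w : Set X), ∃ n : ℤ, θ x - α x - β x = n := by
    intro x hx
    have : (θ x : AddCircle (1 : ℝ)) = ((α x + β x : ℝ) : AddCircle (1 : ℝ)) := by
      rw [AddCircle.coe_add, Lf.coe_eq x hx, Lg.coe_eq x hx, Lfg.coe_eq x hx]
      rfl
    obtain ⟨n, hn⟩ := exists_int_of_coe_eq this
    exact ⟨n, by rw [← hn]; ring⟩
  rcases (w : Set X).eq_empty_or_nonempty with he | ⟨y, hy⟩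
  · exact ⟨0, fun x hx => by simp [he] at hx⟩
  obtain ⟨n, hn⟩ := key y hy
  refine ⟨n, fun x hx => ?_⟩
  obtain ⟨m, hm⟩ := key x hx
  have h1 := abs_lt.1 (Lf.abs_sub_lt x hx y hy)
  have h2 := abs_lt.1 (Lg.abs_sub_lt x hx y hy)
  have h3 := abs_lt.1 (Lfg.abs_sub_lt x hx y hy)
  have h5 : |(m : ℝ) - n| < 1 := abs_lt.2 ⟨by linarith, by linarith⟩
  have : |m - n| < 1 := by exact_mod_cast h5
  rw [Int.abs_lt_one_iff, sub_eq_zero] at this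
  rw [hm, this]

/-- The homomorphism from circle-valued maps on `X` to `Ȟ¹(X)`. -/
noncomputable def circleClass : C(X, AddCircle (1 : ℝ)) →+ Cohomology 1 X :=
  AddMonoidHom.mk' circleClassFun circleClassFun_add

/-- A circle-valued map of trivial class lifts to a real-valued map. -/
theorem exists_lift_of_circleClass_eq_zero {f : C(X, AddCircle (1 : ℝ))}
    (hf : circleClass f = 0) : ∃ θ : C(X, ℝ), ∀ x, (θ x : AddCircle (1 : ℝ)) = f x := by
  obtain ⟨V, τ, b, hb⟩ := exists_coboundary_of_cechClass_eq_zero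
    (c := ⟨liftCochain f, (represents_liftCochain f).mem_cocycles⟩) hf
  choose v hv using V.exists_mem
  have R := (represents_liftCochain f).pullback τ
  have hL (u : V.sets) := (isLiftOn_localLift f _).mono (τ.subset u)
  -- After pullback to `V`, the differences of the local lifts are those of the integers `b`.
  -- Subtracting `b` makes the lifts agree on overlaps, so they glue.
  set θ : X → ℝ := fun x => localLift f (τ.toFun (v x)) x - b (Simplex.point (v x) ⟨x, hv x⟩)
    with hθ
  have key : ∀ (u : V.sets) (x : X) (hu : x ∈ (u : Set X)),
      θ x = localLift f (τ.toFun u) x - b (Simplex.point u ⟨x, hu⟩) := by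
    intro u x hu
    have h1 := R u (v x) x hu (hv x)
    have h2 := congrFun hb (Simplex.edge u (v x) x hu (hv x))
    rw [d_zero_apply] at h2
    have h3 : ((b (Simplex.point (v x) ⟨x, hv x⟩) - b (Simplex.point u ⟨x, hu⟩) : ℤ) : ℝ) = _ :=
      (congrArg (Int.cast (R := ℝ)) h2).trans h1
    push_cast at h3
    simp only [hθ]
    linarith
  refine ⟨⟨θ, continuous_iff_continuousAt.2 fun x => ?_⟩, fun x => ?_⟩
  · have hn : (v x : Set X) ∈ nhds x := (V.isOpen_of_mem _ (v x).2).mem_nhds (hv x)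
    refine ContinuousAt.congr (f := fun y => localLift f (τ.toFun (v x)) y -
      b (Simplex.point (v x) ⟨x, hv x⟩)) (((hL (v x)).continuousOn.continuousAt hn).sub
        continuousAt_const) ?_
    filter_upwards [hn] with y hy
    exact (key _ y hy).symm
  · change ((θ x : ℝ) : AddCircle (1 : ℝ)) = f x
    rw [hθ]
    change ((_ - _ : ℝ) : AddCircle (1 : ℝ)) = f x
    rw [AddCircle.coe_sub, (hL (v x)).coe_eq x (hv x), sub_eq_self]
    rw [AddCircle.coe_eq_zero_iff]
    exact ⟨b (Simplex.point (v x) ⟨x, hv x⟩), by simp⟩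

end Cech

/-! ### Legal words -/

namespace RandomFibonacci

instance : Fintype Letter := ⟨⟨{.a, .b}, by simp⟩, fun x => by cases x <;> simp⟩

variable {p : Set.Ioo (0 : ℝ) 1}

/-- `v` is a realisation of the random image of `u`. -/
def Realises (p : Set.Ioo (0 : ℝ) 1) (u v : List Letter) : Prop := v ∈ (substWord p u).support

theorem mem_support_coin (p : Set.Ioo (0 : ℝ) 1) (c : Bool) : c ∈ (coin p).support := by
  have h0 : ¬ (p : ℝ) ≤ 0 := not_le.2 p.2.1
  have h1 : ¬ (1 : ℝ) ≤ p := not_le.2 p.2.2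
  cases c <;> simp [coin, h0, h1]

theorem Realises.nil : Realises p [] [] := by
  simp [Realises, substWord]

theorem Realises.cons {x : Letter} {u w v : List Letter} (hu : u ∈ (substLetter p x).support)
    (h : Realises p w v) : Realises p (x :: w) (u ++ v) := by
  unfold Realises at *
  simp only [substWord, PMF.mem_support_bind_iff]
  exact ⟨u, hu, v, h, by simp⟩

theorem Realises.cons_ab {w v : List Letter} (h : Realises p w v) :
    Realises p (.a :: w) (.a :: .b :: v) :=
  h.cons (u := [.a, .b]) ((PMF.mem_support_map_iff _ _ _).2 ⟨false, mem_support_coin p _, rfl⟩)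

theorem Realises.cons_ba {w v : List Letter} (h : Realises p w v) :
    Realises p (.a :: w) (.b :: .a :: v) :=
  h.cons (u := [.b, .a]) ((PMF.mem_support_map_iff _ _ _).2 ⟨true, mem_support_coin p _, rfl⟩)

theorem Realises.cons_a {w v : List Letter} (h : Realises p w v) :
    Realises p (.b :: w) (.a :: v) :=
  h.cons (u := [.a]) (by simp [substLetter])

theorem Realises.append {u v u' v' : List Letter} (h : Realises p u v) (h' : Realises p u' v') :
    Realises p (u ++ u') (v ++ v') := by
  induction u generalizing v with
  | nil =>
    have : v = [] := by simpa [Realises, substWord] using h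
    simpa [this]
  | cons x u ih =>
    have h2 := h
    unfold Realises at h2
    simp only [substWord, PMF.mem_support_bind_iff, PMF.support_pure, Set.mem_singleton_iff] at h2
    obtain ⟨y, hy, z, hz, rfl⟩ := h2
    rw [List.append_assoc]
    exact (ih hz).cons hy

/-- The image of a word under the (deterministic) Fibonacci substitution `a ↦ ab`, `b ↦ a`. -/
def fib : List Letter → List Letter
  | [] => []
  | .a :: w => .a :: .b :: fib w
  | .b :: w => .a :: fib w

theorem realises_fib (w : List Letter) : Realises p w (fib w) := by
  induction w with
  | nil => exact .nil
  | cons x w ih => cases x <;> [exact ih.cons_ab; exact ih.cons_a]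

theorem length_le_length_fib (w : List Letter) : w.length ≤ (fib w).length := by
  induction w with
  | nil => simp
  | cons x w ih => cases x <;> simp [fib] <;> omega

theorem isLegal_iff {u : List Letter} :
    IsLegal p u ↔ ∃ v, Relation.ReflTransGen (Realises p) [.b] v ∧ u <:+: v := by
  constructor
  · rintro ⟨k, v, hv, huv⟩
    refine ⟨v, ?_, huv⟩
    clear huv
    induction k generalizing v with
    | zero =>
      have : v = [.b] := by simpa [iterate] using hv
      rw [this]
    | succ k ih =>
      simp only [iterate, PMF.mem_support_bind_iff] at hv
      obtain ⟨w, hw, hv⟩ := hv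
      exact (ih w hw).tail hv
  · rintro ⟨v, hv, huv⟩
    suffices h : ∃ k, v ∈ (iterate p k).support by
      obtain ⟨k, hk⟩ := h
      exact ⟨k, v, hk, huv⟩
    clear huv
    induction hv with
    | refl => exact ⟨0, by simp [iterate]⟩
    | tail _ h ih =>
      obtain ⟨k, hk⟩ := ih
      refine ⟨k + 1, ?_⟩
      simp only [iterate, PMF.mem_support_bind_iff]
      exact ⟨_, hk, h⟩

theorem IsLegal.of_isInfix {u v : List Letter} (hv : IsLegal p v) (h : u <:+: v) : IsLegal p u := by
  obtain ⟨k, w, hw, hvw⟩ := hv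
  exact ⟨k, w, hw, h.trans hvw⟩

/-- While `u` evolves, the flanks follow the deterministic `fib`, which never shortens a word. -/
theorem exists_reflTransGen_append {u v : List Letter} (h : Relation.ReflTransGen (Realises p) u v)
    (x y : List Letter) : ∃ x' y', x.length ≤ x'.length ∧ y.length ≤ y'.length ∧
      Relation.ReflTransGen (Realises p) (x ++ u ++ y) (x' ++ v ++ y') := by
  induction h with
  | refl => exact ⟨x, y, le_rfl, le_rfl, .refl⟩
  | tail _ h ih =>
    obtain ⟨x', y', hx, hy, h'⟩ := ih
    exact ⟨fib x', fib y', hx.trans (length_le_length_fib _), hy.trans (length_le_length_fib _),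
      h'.tail (((realises_fib x').append h).append (realises_fib y'))⟩

theorem reflTransGen_aba : Relation.ReflTransGen (Realises p) [.b] [.a, .b, .a] :=
  ((Relation.ReflTransGen.single (realises_fib [.b])).tail (realises_fib [.a])).tail
    (realises_fib [.a, .b])

theorem IsLegal.extend {u : List Letter} (hu : IsLegal p u) (n : ℕ) :
    ∃ x y, n ≤ x.length ∧ n ≤ y.length ∧ IsLegal p (x ++ u ++ y) := by
  induction n with
  | zero => exact ⟨[], [], le_rfl, le_rfl, by simpa⟩
  | succ n ih =>
    obtain ⟨x, y, hx, hy, h⟩ := ih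
    obtain ⟨v, hv, s, t, rfl⟩ := isLegal_iff.1 h
    -- Since `b` derives `aba`, the derivation of `v` can be rerun from the middle `b`; the two
    -- letters `a` become nonempty flanks.
    obtain ⟨x', y', hx', hy', h'⟩ := exists_reflTransGen_append hv [.a] [.a]
    simp only [List.length_singleton] at hx' hy'
    refine ⟨x' ++ s ++ x, y ++ t ++ y', ?_, ?_,
      isLegal_iff.2 ⟨_, reflTransGen_aba.trans h', ?_⟩⟩
    · simp only [List.length_append]; omega
    · simp only [List.length_append]; omega
    · exact ⟨[], [], by simp⟩

theorem IsLegal.fib {u : List Letter} (hu : IsLegal p u) : IsLegal p (fib u) := by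
  obtain ⟨v, hv, s, t, rfl⟩ := isLegal_iff.1 hu
  exact isLegal_iff.2 ⟨_, hv.tail (((realises_fib s).append (realises_fib u)).append
    (realises_fib t)), ⟨_, _, rfl⟩⟩

/-- The image of a word under the Fibonacci substitution, followed by the letter `a`, with which
the image of every letter begins. -/
def fibA (w : List Letter) : List Letter := fib w ++ [.a]

@[simp] theorem fibA_nil : fibA [] = [.a] := rfl
@[simp] theorem fibA_cons_a (w : List Letter) : fibA (.a :: w) = .a :: .b :: fibA w := rfl
@[simp] theorem fibA_cons_b (w : List Letter) : fibA (.b :: w) = .a :: fibA w := rfl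

theorem exists_fibA_eq_cons (w : List Letter) : ∃ t, fibA w = .a :: t := by
  rcases w with _ | ⟨_ | _, w⟩ <;> simp

theorem fib_append (u v : List Letter) : RandomFibonacci.fib (u ++ v) = fib u ++ fib v := by
  induction u with
  | nil => rfl
  | cons x u ih => cases x <;> simp [RandomFibonacci.fib, ih]

/-- A legal word extends to the right by a letter, and the image of that letter supplies the final
`a`. -/
theorem IsLegal.fibA {u : List Letter} (hu : IsLegal p u) : IsLegal p (fibA u) := by
  obtain ⟨x, y, -, hy, h⟩ := hu.extend 1
  have h2 := h.fib
  rw [fib_append, fib_append] at h2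
  refine h2.of_isInfix ?_
  rcases y with _ | ⟨_ | _, y⟩
  · simp at hy
  · exact ⟨RandomFibonacci.fib x, .b :: RandomFibonacci.fib y, by
      simp [RandomFibonacci.fibA, RandomFibonacci.fib]⟩
  · exact ⟨RandomFibonacci.fib x, RandomFibonacci.fib y, by
      simp [RandomFibonacci.fibA, RandomFibonacci.fib]⟩

/-! ### Counting occurrences -/

open Classical in
/-- The number of occurrences of the nonempty word `v` in `x`. -/
noncomputable def occ (v x : List Letter) : ℕ :=
  ∑ t ∈ Finset.range x.length, if v <+: x.drop t then 1 else 0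

@[simp] theorem occ_nil (v : List Letter) : occ v [] = 0 := by simp [occ]

open Classical in
theorem occ_cons (v x : List Letter) (c : Letter) :
    occ v (c :: x) = occ v x + if v <+: c :: x then 1 else 0 := by
  rw [occ, List.length_cons, Finset.sum_range_succ']
  rfl

/-- Decoding from the left: after a leading `a`, the next letter tells `ab` from `a`. The appended
`a` is essential: `fib [b] = a` is a prefix of `fib [a] = ab`, but `aa` is not a prefix of `aba`. -/
theorem fibA_isPrefix_fibA {u v : List Letter} : fibA u <+: fibA v ↔ u <+: v := by
  induction u generalizing v with
  | nil =>
    obtain ⟨t, ht⟩ := exists_fibA_eq_cons v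
    simp [ht]
  | cons x u ih =>
    obtain ⟨s, hs⟩ := exists_fibA_eq_cons u
    rcases v with _ | ⟨y, v⟩
    · cases x <;> simp [hs]
    · obtain ⟨t, ht⟩ := exists_fibA_eq_cons v
      cases x <;> cases y <;> simp [List.cons_prefix_cons, ih] <;> simp [ht, hs]

/-- An occurrence of `fibA v` starts with `a`, and each `a` of `fibA x` either begins the image of a
letter of `x` or is the appended one, where `fibA v` does not fit. At the beginnings of images,
`fibA_isPrefix_fibA` matches the occurrences. -/
theorem occ_fibA {v : List Letter} (hv : v ≠ []) (x : List Letter) :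
    occ (fibA v) (fibA x) = occ v x := by
  classical
  obtain ⟨s, hs⟩ := exists_fibA_eq_cons v
  induction x with
  | nil =>
    have : ¬ fibA v <+: fibA [] := by rw [fibA_isPrefix_fibA]; simpa
    rw [fibA_nil] at this ⊢
    simp [occ_cons, this]
  | cons c x ih =>
    have h := fibA_isPrefix_fibA (u := v) (v := c :: x)
    cases c
    · rw [fibA_cons_a] at h ⊢
      rw [occ_cons, occ_cons, occ_cons, ih, if_congr h rfl rfl]
      simp [hs]
    · rw [fibA_cons_b] at h ⊢
      rw [occ_cons, occ_cons, ih, if_congr h rfl rfl]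

theorem occ_bb_fibA (x : List Letter) : occ [.b, .b] (fibA x) = 0 := by
  classical
  induction x with
  | nil => simp [occ_cons]
  | cons c x ih =>
    obtain ⟨s, hs⟩ := exists_fibA_eq_cons x
    cases c
    · rw [fibA_cons_a, occ_cons, occ_cons, ih, hs]; simp
    · rw [fibA_cons_b, occ_cons, ih]; simp

theorem iterate_fibA_ne_nil (k : ℕ) : fibA^[k] [.b, .b] ≠ [] := by
  cases k with
  | zero => simp
  | succ k => rw [Function.iterate_succ_apply']; simp [fibA]

theorem occ_iterate_fibA (i k : ℕ) (x : List Letter) :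
    occ (fibA^[i] [.b, .b]) (fibA^[i + k] x) = occ [.b, .b] (fibA^[k] x) := by
  induction i with
  | zero => simp
  | succ i ih =>
    rw [Nat.succ_add, Function.iterate_succ_apply', Function.iterate_succ_apply',
      occ_fibA (iterate_fibA_ne_nil i), ih]

/-- Removing `i` layers leaves the count of `bb` in an image of `fibA`, which is zero. -/
theorem occ_iterate_fibA_of_lt {i k : ℕ} (h : i < k) (x : List Letter) :
    occ (fibA^[i] [.b, .b]) (fibA^[k] x) = 0 := by
  obtain ⟨m, rfl⟩ := Nat.exists_eq_add_of_lt h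
  rw [add_assoc, occ_iterate_fibA, Function.iterate_succ_apply', occ_bb_fibA]

theorem IsLegal.iterate_fibA {u : List Letter} (hu : IsLegal p u) (k : ℕ) :
    IsLegal p (RandomFibonacci.fibA^[k] u) := by
  induction k with
  | zero => exact hu
  | succ k ih => rw [Function.iterate_succ_apply']; exact ih.fibA

theorem count_a_fib (w : List Letter) : (fib w).countP (· matches .a) = w.length := by
  induction w with
  | nil => rfl
  | cons x w ih => cases x <;> simp [fib, ih]

theorem exists_realises_occ_bb (w : List Letter) : ∃ y, Relation.ReflTransGen (Realises p) w y ∧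
    w.countP (· matches .a) ≤ occ [.b, .b] y := by
  -- Exactly three steps are used for every letter, so that the derivations concatenate: `a → ab →
  -- baa → aabba`, which contains `bb`, and `b → a → ab → aba`.
  suffices h : ∃ y₁ y₂ y₃, Realises p w y₁ ∧ Realises p y₁ y₂ ∧ Realises p y₂ y₃ ∧
      w.countP (· matches .a) ≤ occ [.b, .b] y₃ by
    obtain ⟨y₁, y₂, y₃, h₁, h₂, h₃, h⟩ := h
    exact ⟨y₃, ((Relation.ReflTransGen.single h₁).tail h₂).tail h₃, h⟩
  induction w with
  | nil => exact ⟨_, _, _, .nil, .nil, .nil, by simp⟩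
  | cons x w ih =>
    obtain ⟨y₁, y₂, y₃, h₁, h₂, h₃, h⟩ := ih
    cases x
    · refine ⟨_, _, _, h₁.cons_ab, h₂.cons_a.cons_ba, h₃.cons_ba.cons_ab.cons_a, ?_⟩
      simp [occ_cons]
      omega
    · refine ⟨_, _, _, h₁.cons_a, h₂.cons_ab, h₃.cons_a.cons_ab, ?_⟩
      simp [occ_cons]
      omega

theorem exists_isLegal_le_occ_bb (p : Set.Ioo (0 : ℝ) 1) (n : ℕ) :
    ∃ z, IsLegal p z ∧ n ≤ occ [.b, .b] z := by
  have hb : IsLegal p [.b] := isLegal_iff.2 ⟨_, .refl, List.infix_rfl⟩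
  obtain ⟨x, y, hx, -, h⟩ := hb.extend n
  obtain ⟨v, hv, s, t, rfl⟩ := isLegal_iff.1 h
  -- One `fib` step turns length into a number of letters `a`, since every image contains exactly
  -- one `a`.
  obtain ⟨z, hz, hn⟩ := exists_realises_occ_bb (p := p) (fib (s ++ (x ++ [.b] ++ y) ++ t))
  refine ⟨z, isLegal_iff.2 ⟨z, (hv.tail (realises_fib _)).trans hz, List.infix_rfl⟩,
    le_trans ?_ hn⟩
  rw [count_a_fib]
  simp only [List.length_append]
  omega

/-! ### Compactness and bi-infinite extensions of legal words -/

theorem continuous_window (i : ℤ) (n : ℕ) :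
    Continuous fun (w : ℤ → Letter) (j : Fin n) => w (i + (j : ℕ)) :=
  continuous_pi fun _ => continuous_apply _

theorem isClosed_setOf_window (i : ℤ) (n : ℕ) (P : (Fin n → Letter) → Prop) :
    IsClosed {w : ℤ → Letter | P fun j => w (i + (j : ℕ))} :=
  (isClosed_discrete {f | P f}).preimage (continuous_window i n)

theorem isClosed_symbolicSpace (p : Set.Ioo (0 : ℝ) 1) : IsClosed (symbolicSpace p) := by
  simp only [symbolicSpace, Set.ofPred_forall]
  exact isClosed_iInter fun i => isClosed_iInter fun n =>
    isClosed_setOf_window i n fun f => IsLegal p (List.ofFn f)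

theorem isClosed_agree_of_isLegal (p : Set.Ioo (0 : ℝ) 1) (u : List Letter) (N : ℕ) :
    IsClosed {w : ℤ → Letter | (∀ i : Fin u.length, w (i : ℕ) = u[i]) ∧
      ∀ (i : ℤ) (n : ℕ), -(N : ℤ) ≤ i → i + n ≤ N →
        IsLegal p (List.ofFn fun j : Fin n => w (i + (j : ℕ)))} := by
  refine IsClosed.and ?_ ?_
  · simp only [Set.ofPred_forall]
    exact isClosed_iInter fun i => isClosed_eq (continuous_apply _) continuous_const
  · simp only [Set.ofPred_forall]
    exact isClosed_iInter fun i => isClosed_iInter fun n => isClosed_iInter fun _ =>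
      isClosed_iInter fun _ => isClosed_setOf_window i n fun f => IsLegal p (List.ofFn f)

/-- Every legal word occurs at the origin of a bi-infinite word of the symbolic space. -/
theorem IsLegal.exists_mem_symbolicSpace {u : List Letter} (hu : IsLegal p u) :
    ∃ w ∈ symbolicSpace p, ∀ i : Fin u.length, w (i : ℕ) = u[i] := by
  have key : ∃ w : ℤ → Letter, w ∈ ⋂ N : ℕ, {w : ℤ → Letter |
      (∀ i : Fin u.length, w (i : ℕ) = u[i]) ∧ ∀ (i : ℤ) (n : ℕ), -(N : ℤ) ≤ i → i + n ≤ N →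
        IsLegal p (List.ofFn fun j : Fin n => w (i + (j : ℕ)))} := by
    -- Cantor's intersection theorem for the conditions imposed on the windows `[-N, N)`.
    refine IsCompact.nonempty_iInter_of_sequence_nonempty_isCompact_isClosed _ ?_ ?_ ?_ ?_
    · rintro N w ⟨h1, h2⟩
      exact ⟨h1, fun i n hi hn => h2 i n (by push_cast; omega) (by push_cast; omega)⟩
    · intro N
      obtain ⟨x, y, hx, hy, h⟩ := hu.extend N
      -- The values beyond the finite word are arbitrary: both flanks have length at least `N`, so
      -- the window `[-N, N)` lies within it.
      refine ⟨fun i => (x ++ u ++ y).getD (i + x.length).toNat .a, fun i => ?_,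
        fun i n hi hn => h.of_isInfix ?_⟩
      · have h1 : ((((i : ℕ) : ℤ) + x.length).toNat) = x.length + i := by omega
        simp only [h1, List.append_assoc]
        rw [List.getD_eq_getElem _ _ (by simp only [List.length_append]; omega),
          List.getElem_append_right (by omega),
          List.getElem_append_left (by simp)]
        simp
      · have e : (List.ofFn fun j : Fin n =>
            (x ++ u ++ y).getD (i + (j : ℕ) + x.length).toNat .a) =
            ((x ++ u ++ y).drop (i + x.length).toNat).take n := by
          apply List.ext_getElem
          · simp only [List.length_ofFn, List.length_take, List.length_drop, List.length_append]
            omega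
          · intro m h1 h2
            simp only [List.length_ofFn] at h1
            have h3 : (i + (m : ℕ) + x.length).toNat = (i + x.length).toNat + m := by omega
            rw [List.getElem_ofFn, List.getElem_take, List.getElem_drop]
            simp only [h3]
            rw [List.getD_eq_getElem]
        rw [e]
        exact (List.take_prefix _ _).isInfix.trans (List.drop_suffix _ _).isInfix
    · exact (isClosed_agree_of_isLegal p u 0).isCompact
    · exact isClosed_agree_of_isLegal p u
  obtain ⟨w, hw⟩ := key
  rw [Set.mem_iInter] at hw
  exact ⟨w, fun i n => (hw (i.natAbs + n)).2 i n (by omega) (by omega),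
    (hw 0).1⟩

end RandomFibonacci

/-! ### Circle-valued maps on the tiling space -/

namespace RandomFibonacci

variable {p : Set.Ioo (0 : ℝ) 1}

/-- The `n`-th power of the shift, for an integer `n`. -/
def shiftBy (n : ℤ) (w : symbolicSpace p) : symbolicSpace p :=
  ⟨fun i => w.1 (i + n), fun i k => by
    have h := w.2 (i + n) k
    have e : (fun j : Fin k => w.1 (i + n + (j : ℕ))) = fun j : Fin k => w.1 (i + (j : ℕ) + n) := by
      funext j
      exact congrArg w.1 (by ring)
    rwa [e] at h⟩

theorem shiftBy_zero (w : symbolicSpace p) : shiftBy 0 w = w :=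
  Subtype.ext (funext fun i => congrArg w.1 (add_zero i))

theorem shiftBy_sub_one_shift (n : ℤ) (w : symbolicSpace p) :
    shiftBy (n - 1) (shift w) = shiftBy n w :=
  Subtype.ext (funext fun i => congrArg w.1 (by ring))

theorem continuous_shiftBy (n : ℤ) : Continuous (shiftBy n : symbolicSpace p → symbolicSpace p) :=
  continuous_induced_rng.2 <| continuous_pi fun i =>
    (continuous_apply (i + n)).comp continuous_subtype_val

/-- The circle-valued map on `symbolicSpace p × ℝ` that winds `g (Sⁿ w)` times around the circle
as `t` runs from `n` to `n + 1`. -/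
noncomputable def windingFun (g : C(symbolicSpace p, ℤ)) (x : symbolicSpace p × ℝ) :
    AddCircle (1 : ℝ) :=
  ((Int.fract x.2 * g (shiftBy ⌊x.2⌋ x.1) : ℝ) : AddCircle (1 : ℝ))

theorem coe_int_eq_zero (k : ℤ) : ((k : ℝ) : AddCircle (1 : ℝ)) = 0 :=
  (AddCircle.coe_eq_zero_iff (1 : ℝ)).2 ⟨k, by simp⟩

/-- Just left of `n` the defining formula differs from `(t - n) * g (shiftBy (n - 1) w)` by the
integer `g (shiftBy (n - 1) w)`. Modulo 1 the jump of the floor disappears, leaving an expression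
continuous across `n`. -/
theorem windingFun_eq (g : C(symbolicSpace p, ℤ)) (n : ℤ) (w : symbolicSpace p) (t : ℝ)
    (h1 : (n : ℝ) - 1 < t) (h2 : t < n + 1) :
    windingFun g (w, t) = ((max (t - n) 0 * g (shiftBy n w) +
      min (t - n) 0 * g (shiftBy (n - 1) w) :
      ℝ) : AddCircle (1 : ℝ)) := by
  rcases le_or_gt (n : ℝ) t with h | h
  · have e : ⌊t⌋ = n := Int.floor_eq_iff.2 ⟨h, h2⟩
    simp only [windingFun, Int.fract, e]
    rw [max_eq_left (by linarith), min_eq_right (by linarith)]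
    simp
  · have e : ⌊t⌋ = n - 1 := Int.floor_eq_iff.2 ⟨by push_cast; linarith, by push_cast; linarith⟩
    simp only [windingFun, Int.fract, e]
    rw [max_eq_right (by linarith), min_eq_left (by linarith), ← sub_eq_zero, ← AddCircle.coe_sub]
    convert coe_int_eq_zero (g (shiftBy (n - 1) w)) using 2
    push_cast
    ring

theorem continuous_windingFun (g : C(symbolicSpace p, ℤ)) : Continuous (windingFun g) := by
  refine continuous_iff_continuousAt.2 fun ⟨w, t⟩ => ?_
  have hg (n : ℤ) : Continuous fun x : symbolicSpace p × ℝ => ((g (shiftBy n x.1) : ℤ) : ℝ) :=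
    (continuous_of_discreteTopology (f := (Int.cast : ℤ → ℝ))).comp
      (g.continuous.comp ((continuous_shiftBy n).comp continuous_fst))
  have hc : Continuous fun x : symbolicSpace p × ℝ =>
      ((max (x.2 - ⌊t⌋) 0 * g (shiftBy ⌊t⌋ x.1) +
        min (x.2 - ⌊t⌋) 0 * g (shiftBy (⌊t⌋ - 1) x.1) : ℝ) : AddCircle (1 : ℝ)) := by
    refine (AddCircle.continuous_mk' 1).comp ?_
    exact (((continuous_snd.sub continuous_const).max continuous_const).mul (hg _)).add
      (((continuous_snd.sub continuous_const).min continuous_const).mul (hg _))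
  refine hc.continuousAt.congr ?_
  have ho : IsOpen {x : symbolicSpace p × ℝ | x.2 ∈ Set.Ioo ((⌊t⌋ : ℝ) - 1) (⌊t⌋ + 1)} :=
    isOpen_Ioo.preimage continuous_snd
  filter_upwards [ho.mem_nhds
    (show t ∈ Set.Ioo _ _ from ⟨by linarith [Int.floor_le t], Int.lt_floor_add_one t⟩)] with x hx
  exact (windingFun_eq g ⌊t⌋ x.1 x.2 hx.1 hx.2).symm

/-- The circle-valued map on the tiling space that winds `g w` times around the circle along the
tile at the origin of `w`. -/
noncomputable def winding (g : C(symbolicSpace p, ℤ)) :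
    C(TilingSpace p, AddCircle (1 : ℝ)) where
  toFun := Quot.lift (windingFun g) fun x y h => by
    obtain ⟨w, t⟩ := x
    subst h
    simp only [windingFun, Int.floor_sub_one, shiftBy_sub_one_shift, Int.fract_sub_one]
  continuous_toFun := continuous_quot_lift _ (continuous_windingFun g)

theorem winding_mk (g : C(symbolicSpace p, ℤ)) (w : symbolicSpace p) {t : ℝ}
    (ht : t ∈ Set.Icc (0 : ℝ) 1) :
    winding g (Quot.mk _ (w, t)) = ((t * g w : ℝ) : AddCircle (1 : ℝ)) := by
  change windingFun g (w, t) = _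
  rcases ht.2.lt_or_eq with h | rfl
  · have e : ⌊t⌋ = 0 := Int.floor_eq_zero_iff.2 ⟨ht.1, h⟩
    simp only [windingFun, Int.fract, e, shiftBy_zero]
    simp
  · rw [one_mul, coe_int_eq_zero]
    simp [windingFun]

instance (p : Set.Ioo (0 : ℝ) 1) : CompactSpace (symbolicSpace p) := by
  exact isCompact_iff_compactSpace.1 (isClosed_symbolicSpace p).isCompact

/-- A circle-valued map on the tiling space that winds `G w` times along the tile at the origin of
`w` has trivial class only if `G` is the coboundary of a bounded function. -/
theorem exists_bounded_of_circleClass_eq_zero {f : C(TilingSpace p, AddCircle (1 : ℝ))}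
    {G : symbolicSpace p → ℤ}
    (hG : ∀ w, ∀ t ∈ Set.Icc (0 : ℝ) 1, f (Quot.mk _ (w, t)) = ((t * G w : ℝ) : AddCircle (1 : ℝ)))
    (hf : Cech.circleClass f = 0) :
    ∃ (h : symbolicSpace p → ℝ) (C : ℝ), (∀ w, |h w| ≤ C) ∧ ∀ w, (G w : ℝ) = h (shift w) - h w := by
  obtain ⟨θ, hθ⟩ := Cech.exists_lift_of_circleClass_eq_zero hf
  have hc : Continuous fun w : symbolicSpace p => θ (Quot.mk _ (w, 0)) :=
    θ.continuous.comp (continuous_quot_mk.comp (continuous_id.prodMk continuous_const))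
  obtain ⟨C, hC⟩ := isCompact_univ.exists_bound_of_continuousOn hc.continuousOn
  refine ⟨fun w => θ (Quot.mk _ (w, 0)), C, fun w => hC w trivial, fun w => ?_⟩
  have hp : Continuous fun t : ℝ => θ (Quot.mk _ (w, t)) - t * G w :=
    (θ.continuous.comp (continuous_quot_mk.comp (continuous_const.prodMk continuous_id))).sub
      (continuous_id.mul continuous_const)
  -- Along a tile, `θ - t * G w` is continuous with integer values, hence constant. Comparing its
  -- ends, with `(w, 1) ∼ (S w, 0)`, gives the coboundary equation for `h w = θ(w, 0)`.
  have key := (isPreconnected_Icc (a := (0 : ℝ)) (b := 1)).constant_of_mapsTo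
    (T := (AddSubgroup.zmultiples (1 : ℝ) : Set ℝ)) 
    ⟨inferInstanceAs (DiscreteTopology (AddSubgroup.zmultiples (1 : ℝ)))⟩ hp.continuousOn
    (fun t ht => by
      refine (QuotientAddGroup.eq_zero_iff _).1 ?_
      change ((_ - _ : ℝ) : AddCircle (1 : ℝ)) = 0
      rw [AddCircle.coe_sub, hθ, hG w t ht, sub_self])
    (Set.right_mem_Icc.2 zero_le_one) (Set.left_mem_Icc.2 zero_le_one)
  have e : (Quot.mk _ (w, 1) : TilingSpace p) = Quot.mk _ (shift w, 0) :=
    Quot.sound (by simp)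
  simp only [e] at key
  linarith

end RandomFibonacci

/-! ### Birkhoff sums and independence of the cylinder classes -/

namespace RandomFibonacci

variable {p : Set.Ioo (0 : ℝ) 1}

theorem shift_iterate_apply (n : ℕ) (w : symbolicSpace p) (i : ℤ) :
    (shift^[n] w).1 i = w.1 (i + n) := by
  induction n generalizing i with
  | zero => simp
  | succ n ih =>
    rw [Function.iterate_succ_apply']
    exact (ih (i + 1)).trans (congrArg w.1 (by push_cast; ring))

open Classical in
/-- The indicator function of the set of the bi-infinite words with the word `v` at the origin. -/
noncomputable def cylinder (p : Set.Ioo (0 : ℝ) 1) (v : List Letter) : C(symbolicSpace p, ℤ) where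
  toFun w := if (List.ofFn fun j : Fin v.length => w.1 (0 + (j : ℕ))) = v then 1 else 0
  continuous_toFun := (continuous_of_discreteTopology
    (f := fun f : Fin v.length → Letter => if List.ofFn f = v then (1 : ℤ) else 0)).comp
      ((continuous_window 0 v.length).comp continuous_subtype_val)

theorem cylinder_mem_Icc (v : List Letter) (w : symbolicSpace p) :
    0 ≤ cylinder p v w ∧ cylinder p v w ≤ 1 := by
  classical
  change 0 ≤ (if _ then _ else _ : ℤ) ∧ (if _ then _ else _ : ℤ) ≤ 1
  split_ifs <;> simp

open Classical in
theorem cylinder_shift_iterate (v x : List Letter) {w : symbolicSpace p}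
    (hw : ∀ i : Fin x.length, w.1 (i : ℕ) = x[i]) {t : ℕ} (ht : t + v.length ≤ x.length) :
    cylinder p v (shift^[t] w) = if v <+: x.drop t then 1 else 0 := by
  change (if (List.ofFn fun j : Fin v.length => (shift^[t] w).1 (0 + (j : ℕ))) = v
    then _ else _) = _
  refine if_congr ?_ rfl rfl
  have e : (List.ofFn fun j : Fin v.length => (shift^[t] w).1 (0 + (j : ℕ))) =
      (x.drop t).take v.length := by
    apply List.ext_getElem
    · simp only [List.length_ofFn, List.length_take, List.length_drop]
      omega
    · intro m h1 h2
      simp only [List.length_ofFn] at h1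
      rw [List.getElem_ofFn, List.getElem_take, List.getElem_drop, shift_iterate_apply]
      refine Eq.trans ?_ (hw ⟨t + m, by omega⟩)
      exact congrArg w.1 (by push_cast; ring)
  rw [e, List.prefix_iff_eq_take, eq_comm]

/-- The Birkhoff sums of a cylinder function count the occurrences of a word. -/
theorem abs_sum_cylinder_sub_occ_le (v x : List Letter) {w : symbolicSpace p}
    (hw : ∀ i : Fin x.length, w.1 (i : ℕ) = x[i]) :
    |(∑ t ∈ Finset.range x.length, cylinder p v (shift^[t] w)) - (occ v x : ℤ)| ≤ v.length := by
  classical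
  rw [occ, Nat.cast_sum, ← Finset.sum_sub_distrib]
  refine (Finset.abs_sum_le_sum_abs _ _).trans ?_
  -- The two counts can differ only at the last `v.length` positions, where the window may overrun
  -- `x`, and there by at most 1.
  have h : ∀ t ∈ Finset.range x.length, |cylinder p v (shift^[t] w) -
      ((if v <+: x.drop t then 1 else 0 : ℕ) : ℤ)| ≤
        if t ∈ Finset.Ico (x.length - v.length) x.length then 1 else 0 := by
    intro t ht
    rw [Finset.mem_range] at ht
    split_ifs with h1 h2 h2
    · have := cylinder_mem_Icc v (shift^[t] w)
      rw [abs_le]; push_cast; omega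
    · rw [cylinder_shift_iterate v x hw (by simp at h2; omega), if_pos h1]; simp
    · have := cylinder_mem_Icc v (shift^[t] w)
      rw [abs_le]; push_cast; omega
    · rw [cylinder_shift_iterate v x hw (by simp at h2; omega), if_neg h1]; simp
  refine (Finset.sum_le_sum h).trans ?_
  rw [Finset.sum_ite_mem, Finset.sum_const, nsmul_one]
  have : (Finset.range x.length ∩ Finset.Ico (x.length - v.length) x.length).card ≤ v.length :=
    (Finset.card_le_card Finset.inter_subset_right).trans (by rw [Nat.card_Ico]; omega)
  exact_mod_cast this

/-- If an integral combination of cylinder functions is the coboundary of a bounded function, then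
the corresponding combination of numbers of occurrences is bounded on the legal words. -/
theorem exists_abs_sum_occ_le {ι : Type*} (s : Finset ι) (m : ι → ℤ) (v : ι → List Letter)
    {h : symbolicSpace p → ℝ} {C : ℝ} (hC : ∀ w, |h w| ≤ C)
    (hh : ∀ w, ((∑ i ∈ s, m i * cylinder p (v i) w : ℤ) : ℝ) = h (shift w) - h w) :
    ∃ M : ℝ, ∀ x, IsLegal p x → |((∑ i ∈ s, m i * (occ (v i) x : ℤ) : ℤ) : ℝ)| ≤ M := by
  -- The telescoping sum of the coboundary contributes `2 * C`; the remainder is the end error of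
  -- each cylinder function.
  refine ⟨2 * C + ((∑ i ∈ s, |m i| * (v i).length : ℤ) : ℝ), fun x hx => ?_⟩
  obtain ⟨w, hw, hwx⟩ := hx.exists_mem_symbolicSpace
  lift w to symbolicSpace p using hw
  set B : ℤ := ∑ t ∈ Finset.range x.length, ∑ i ∈ s, m i * cylinder p (v i) (shift^[t] w) with hB
  have h1 : |(B : ℝ)| ≤ 2 * C := by
    have e : (B : ℝ) = h (shift^[x.length] w) - h w := by
      rw [hB, Int.cast_sum]
      simp only [hh, ← Function.iterate_succ_apply' shift]
      exact Finset.sum_range_sub (fun t => h (shift^[t] w)) _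
    rw [e]
    have h2 := abs_le.1 (hC (shift^[x.length] w))
    have h3 := abs_le.1 (hC w)
    exact abs_le.2 ⟨by linarith, by linarith⟩
  have h2 : |B - ∑ i ∈ s, m i * (occ (v i) x : ℤ)| ≤ ∑ i ∈ s, |m i| * (v i).length := by
    rw [hB, Finset.sum_comm, ← Finset.sum_sub_distrib]
    refine (Finset.abs_sum_le_sum_abs _ _).trans (Finset.sum_le_sum fun i _ => ?_)
    rw [← Finset.mul_sum, ← mul_sub, abs_mul]
    exact mul_le_mul_of_nonneg_left (abs_sum_cylinder_sub_occ_le (v i) x hwx) (abs_nonneg _)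
  have h2' : |(B : ℝ) - ((∑ i ∈ s, m i * (occ (v i) x : ℤ) : ℤ) : ℝ)| ≤
      ((∑ i ∈ s, |m i| * (v i).length : ℤ) : ℝ) := by exact_mod_cast h2
  have h3 := abs_le.1 h1
  have h4 := abs_le.1 h2'
  exact abs_le.2 ⟨by linarith, by linarith⟩

/-- The class in `Ȟ¹` of the cylinder function of the `k`-th image of the word `bb`. -/
noncomputable def cylinderClass (p : Set.Ioo (0 : ℝ) 1) (k : ℕ) :
    Cech.Cohomology 1 (TilingSpace p) :=
  Cech.circleClass (winding (cylinder p (fibA^[k] [.b, .b])))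

theorem linearIndependent_cylinderClass (p : Set.Ioo (0 : ℝ) 1) :
    LinearIndependent ℤ (cylinderClass p) := by
  rw [linearIndependent_iff']
  intro s m hs
  by_contra! hne
  obtain ⟨i₀, hi₀, hmi₀⟩ := hne
  -- The largest index with nonzero coefficient: on `fibA^[j] z` smaller indices have count zero and
  -- larger ones coefficient zero.
  obtain ⟨j, hj, hmax⟩ := Finset.exists_max_image (s.filter fun i => m i ≠ 0) id
    ⟨i₀, Finset.mem_filter.2 ⟨hi₀, hmi₀⟩⟩
  rw [Finset.mem_filter] at hj
  have hz : Cech.circleClass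
      (∑ i ∈ s, m i • winding (cylinder p (fibA^[i] [.b, .b]))) = 0 := by
    rw [map_sum, ← hs]
    exact Finset.sum_congr rfl fun i _ => map_zsmul _ _ _
  obtain ⟨h, C, hC, hh⟩ := exists_bounded_of_circleClass_eq_zero
    (G := fun w => ∑ i ∈ s, m i * cylinder p (fibA^[i] [.b, .b]) w) (fun w t ht => by
      rw [ContinuousMap.sum_apply]
      push_cast
      rw [Finset.mul_sum]
      refine Eq.trans (Finset.sum_congr rfl fun i _ => ?_)
        (map_sum (QuotientAddGroup.mk' (AddSubgroup.zmultiples (1 : ℝ))) _ s).symm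
      rw [Pi.smul_apply, winding_mk _ w ht, ← AddCircle.coe_zsmul, zsmul_eq_mul, mul_left_comm]
      rfl) hz
  obtain ⟨M, hM⟩ := exists_abs_sum_occ_le s m _ hC hh
  obtain ⟨n, hn⟩ := exists_nat_gt M
  obtain ⟨z, hz, hnz⟩ := exists_isLegal_le_occ_bb p n
  have hx := hM _ (hz.iterate_fibA j)
  rw [Finset.sum_eq_single_of_mem j hj.1] at hx
  · rw [show fibA^[j] z = fibA^[j + 0] z from rfl, occ_iterate_fibA] at hx
    have h1 : (1 : ℤ) ≤ |m j| := Int.one_le_abs hj.2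
    have h2 : (n : ℤ) ≤ |m j * (occ [.b, .b] z : ℤ)| := by
      rw [abs_mul, Nat.abs_cast]
      have : (n : ℤ) ≤ occ [.b, .b] z := by exact_mod_cast hnz
      nlinarith
    have h3 : (n : ℝ) ≤ |((m j * (occ [.b, .b] z : ℤ) : ℤ) : ℝ)| := by exact_mod_cast h2
    exact absurd (h3.trans hx) (not_le.2 hn)
  · intro i hi hij
    rcases lt_or_gt_of_ne hij with h | h
    · rw [occ_iterate_fibA_of_lt h]; simp
    · have : m i = 0 := by
        by_contra hmi
        exact absurd (hmax i (Finset.mem_filter.2 ⟨hi, hmi⟩)) (not_le.2 h)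
      simp [this]

end RandomFibonacci

theorem mainTheorem1 (p : Set.Ioo (0 : ℝ) 1) :
    ¬ AddGroup.FG (Cech.Cohomology 1 (RandomFibonacci.TilingSpace p)) := by
  intro h
  have : Module.Finite ℤ (Cech.Cohomology 1 (RandomFibonacci.TilingSpace p)) :=
    Module.Finite.iff_addGroup_fg.2 h
  -- An independent family in a finitely generated ℤ-module has a finite index type, but this one is
  -- indexed by ℕ.
  exact not_finite_iff_infinite.2 inferInstance
    (RandomFibonacci.linearIndependent_cylinderClass p).finite
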